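/- Let $\mathbb{H}=\{z\in\mathbb{C}:\operatorname{Im} z>0\}$. Let $\Phi:\mathbb{H}\to\mathbb{H}$ be analytic and of hyperbolic type with Denjoy–Wolff point at $\infty$ and dilation $A$, that is, $$A=\inf_{z\in\mathbb{H}}\frac{\operatorname{Im}\Phi(z)}{\operatorname{Im} z}>1 .$$ Say that a function $f$ on $\mathbb{H}$ has non-tangential limit $L$ at $\infty$ if, for every $\delta>0$, $f(z)\to L$ as $z\to\infty$ within the sector $\{z:|\operatorname{Arg} z-\pi/2|<\pi/2-\delta\}$. Let $\sigma:\mathbb{H}\to\mathbb{H}$ be analytic with $$\sigma\circ\Phi=A\sigma .$$ Then $\sigma$ has non-tangential limit $\infty$ at $\infty$, and $\sigma$ is semi-conformal at $\infty$, i.e. $\operatorname{Arg}\frac{\sigma(z)}{z}$ has non-tangential limit $0$ at $\infty$. Moreover, every analytic $\tilde\sigma:\mathbb{H}\to\mathbb{H}$ with $\tilde\sigma\circ\Phi=A\tilde\sigma$ is of the form $\tilde\sigma=c\,\sigma$ for some real constant $c>0$. -/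

import Mathlib

open Filter Topology UpperHalfPlane

/-- `f` restricts to an analytic self-map of the open upper half-plane `{z | 0 < im z}`
(the values of `f` outside the upper half-plane are irrelevant). -/
def IsAnalyticSelfMap (f : ℂ → ℂ) : Prop :=
  AnalyticOnNhd ℂ f upperHalfPlaneSet ∧ Set.MapsTo f upperHalfPlaneSet upperHalfPlaneSet

/-- `Φ` is a self-map of the upper half-plane of hyperbolic type, normalised so that its
Denjoy-Wolff point is `∞`, with dilation `A = inf (im Φ z / im z) > 1`. -/
def IsHyperbolicType (Φ : ℂ → ℂ) (A : ℝ) : Prop :=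
  IsAnalyticSelfMap Φ ∧ 1 < A ∧
    IsGLB ((fun z : ℂ => (Φ z).im / z.im) '' upperHalfPlaneSet) A

/-- The sector `|Arg z - π / 2| < π / 2 - δ`; for `δ > 0` it lies in the upper half-plane. -/
def sector (δ : ℝ) : Set ℂ :=
  {z : ℂ | |z.arg - Real.pi / 2| < Real.pi / 2 - δ}

/-- `f` has non-tangential limit at `∞` along the filter `l`: for every `δ > 0`, `f z` tends to `l`
as `z` tends to `∞` inside the sector `|Arg z - π / 2| < π / 2 - δ`. -/
def NonTangentialLimit {β : Type*} (f : ℂ → β) (l : Filter β) : Prop :=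
  ∀ δ : ℝ, 0 < δ → Tendsto f (Bornology.cobounded ℂ ⊓ 𝓟 (sector δ)) l

/-- `σ` is semi-conformal at `∞`: the argument of `σ z / z` has non-tangential limit `0`. -/
def IsSemiConformal (σ : ℂ → ℂ) : Prop :=
  NonTangentialLimit (fun z : ℂ => (σ z / z).arg) (𝓝 0)

/-- The functional equation `σ ∘ Φ = A σ` on the upper half-plane. -/
def Intertwines (σ Φ : ℂ → ℂ) (A : ℝ) : Prop :=
  ∀ z ∈ upperHalfPlaneSet, σ (Φ z) = (A : ℂ) * σ z

/-!
Let `Φ` be of hyperbolic type with dilation `A`. By the Julia–Wolff theorem `Φ z` is hyperbolically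
close to `A z` in cones at `∞`, so Schwarz–Pick turns `σ ∘ Φ = A σ` into `σ (A z) / σ z → A` there.
The blow-downs `z ↦ σ (t z) / |σ (t i)|` form a normal family, and each of their limits as `t → ∞`
is a Pick function commuting with the dilation by `A`; Julia–Wolff applied to the limit makes it
linear, hence the identity. Uniform convergence on compact subsets of a cone is semi-conformality,
and growth by a factor close to `A` along the imaginary axis gives `σ → ∞`.

Let `σ'` be another solution. Each orbit of `Φ` tends to `∞` inside a cone, where
`arg (σ' / σ) → 0` by semi-conformality. Since `σ' / σ` is constant along orbits, it is everywhere
positive, and an analytic function with real values is constant.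
-/

/-! ### Schwarz–Pick estimates -/

/-- The restriction of an analytic self-map to the type `ℍ`, which carries the hyperbolic metric. -/
def IsAnalyticSelfMap.selfMap {f : ℂ → ℂ} (hf : IsAnalyticSelfMap f) (z : ℍ) : ℍ :=
  ⟨f z, hf.2 z.im_pos⟩

theorem IsAnalyticSelfMap.map_ne_zero {f : ℂ → ℂ} (hf : IsAnalyticSelfMap f) (z : ℍ) : f z ≠ 0 :=
  (hf.selfMap z).ne_zero

theorem IsAnalyticSelfMap.norm_map_mul_I_pos {f : ℂ → ℂ} (hf : IsAnalyticSelfMap f) {t : ℝ}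
    (ht : 0 < t) : 0 < ‖f (t * Complex.I)‖ :=
  norm_pos_iff.2 (hf.map_ne_zero ⟨t * Complex.I, by simpa using ht⟩)

/-- The inverse of the Cayley transform `z ↦ (z - w) / (z - conj w)`; it maps the unit disc to the
upper half-plane and `0` to `w`. -/
noncomputable def invCayley (w : ℍ) (ξ : ℂ) : ℂ :=
  (w - starRingEnd ℂ w * ξ) / (1 - ξ)

theorem norm_cayley_eq_tanh (z w : ℍ) :
    ‖((z : ℂ) - w) / (z - starRingEnd ℂ w)‖ = Real.tanh (dist z w / 2) := by
  rw [tanh_half_dist, norm_div, dist_eq_norm, dist_eq_norm]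

theorem coe_sub_conj_ne_zero (z w : ℍ) : (z : ℂ) - starRingEnd ℂ w ≠ 0 := by
  intro h
  have him : z.im + w.im = 0 := by simpa using congrArg Complex.im h
  exact (add_pos z.im_pos w.im_pos).ne' him

theorem one_sub_ne_zero_of_norm_lt_one {ξ : ℂ} (hξ : ‖ξ‖ < 1) : 1 - ξ ≠ 0 := by
  rintro h
  simp [← sub_eq_zero.1 h] at hξ

theorem invCayley_zero (w : ℍ) : invCayley w 0 = w := by
  simp [invCayley]

theorem invCayley_cayley (z w : ℍ) :
    invCayley w ((z - w) / (z - starRingEnd ℂ w)) = z := by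
  have hz := coe_sub_conj_ne_zero z w
  have hw := coe_sub_conj_ne_zero w w
  have hden : 1 - ((z : ℂ) - w) / (z - starRingEnd ℂ w) =
      (w - starRingEnd ℂ w) / (z - starRingEnd ℂ w) := by
    field_simp
    ring
  rw [invCayley, hden]
  field_simp
  ring

theorem differentiableOn_invCayley (w : ℍ) :
    DifferentiableOn ℂ (invCayley w) (Metric.ball 0 1) :=
  DifferentiableOn.div (by fun_prop) (by fun_prop) fun _ hξ =>
    one_sub_ne_zero_of_norm_lt_one (mem_ball_zero_iff.1 hξ)

theorem invCayley_im (w : ℍ) (ξ : ℂ) :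
    (invCayley w ξ).im = w.im * (1 - ‖ξ‖ ^ 2) / ‖1 - ξ‖ ^ 2 := by
  simp only [invCayley, Complex.div_im, ← Complex.normSq_eq_norm_sq, Complex.normSq_apply]
  rw [← sub_div]
  congr 1
  simp
  ring

theorem mapsTo_invCayley (w : ℍ) :
    Set.MapsTo (invCayley w) (Metric.ball 0 1) upperHalfPlaneSet := by
  intro ξ hξ
  rw [mem_ball_zero_iff] at hξ
  have hsq : ‖ξ‖ ^ 2 < 1 := (sq_lt_one_iff₀ (norm_nonneg ξ)).2 hξ
  have hden := norm_pos_iff.2 (one_sub_ne_zero_of_norm_lt_one hξ)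
  change 0 < (invCayley w ξ).im
  rw [invCayley_im]
  have := w.im_pos
  have := sub_pos.2 hsq
  positivity

-- Conjugating `f` by the Cayley transforms at `w` and `f w` reduces this to Schwarz's lemma.
theorem IsAnalyticSelfMap.dist_selfMap_le {f : ℂ → ℂ} (hf : IsAnalyticSelfMap f) (z w : ℍ) :
    dist (hf.selfMap z) (hf.selfMap w) ≤ dist z w := by
  set g : ℂ → ℂ := fun ξ =>
    (f (invCayley w ξ) - f w) / (f (invCayley w ξ) - starRingEnd ℂ (f w))
  have hg_norm (u : ℍ) :
      ‖(f u - f w) / (f u - starRingEnd ℂ (f w))‖ =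
        Real.tanh (dist (hf.selfMap u) (hf.selfMap w) / 2) :=
    norm_cayley_eq_tanh (hf.selfMap u) (hf.selfMap w)
  have hfc : DifferentiableOn ℂ (fun ξ => f (invCayley w ξ)) (Metric.ball 0 1) :=
    hf.1.differentiableOn.comp (differentiableOn_invCayley w) (mapsTo_invCayley w)
  have hg : DifferentiableOn ℂ g (Metric.ball 0 1) :=
    (hfc.sub_const _).div (hfc.sub_const _) fun ξ hξ =>
      coe_sub_conj_ne_zero (hf.selfMap ⟨_, mapsTo_invCayley w hξ⟩) (hf.selfMap w)
  have hg_maps : Set.MapsTo g (Metric.ball 0 1) (Metric.closedBall 0 1) := fun ξ hξ => by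
    rw [mem_closedBall_zero_iff]
    exact (hg_norm ⟨_, mapsTo_invCayley w hξ⟩).trans_le (Real.tanh_lt_one _).le
  have hg_zero : g 0 = 0 := by simp [g, invCayley_zero]
  have hschwarz := Complex.norm_le_norm_of_mapsTo_ball hg hg_maps hg_zero
    ((norm_cayley_eq_tanh z w).trans_lt (Real.tanh_lt_one _))
  simp only [g, invCayley_cayley] at hschwarz
  rw [hg_norm, norm_cayley_eq_tanh] at hschwarz
  have hhalf := Real.artanh_le_artanh (Real.neg_one_lt_tanh _) (Real.tanh_lt_one _) hschwarz
  rw [Real.artanh_tanh, Real.artanh_tanh] at hhalf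
  linarith

/-- A Pick (or Nevanlinna) function: an analytic map of the upper half-plane to its closure.
Unlike self-maps, these are closed under pointwise limits and under subtracting the linear term
in the Julia–Wolff theorem. -/
structure IsPick (f : ℂ → ℂ) : Prop where
  differentiableOn : DifferentiableOn ℂ f upperHalfPlaneSet
  im_nonneg : ∀ z : ℍ, 0 ≤ (f z).im

theorem IsAnalyticSelfMap.isPick {f : ℂ → ℂ} (hf : IsAnalyticSelfMap f) : IsPick f :=
  ⟨hf.1.differentiableOn, fun z => (hf.selfMap z).im_pos.le⟩

theorem IsPick.isAnalyticSelfMap_add {f : ℂ → ℂ} (hf : IsPick f) {ε : ℝ} (hε : 0 < ε) :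
    IsAnalyticSelfMap fun z => f z + ε * Complex.I := by
  refine ⟨(hf.differentiableOn.add_const _).analyticOnNhd isOpen_upperHalfPlaneSet, fun z hz => ?_⟩
  simpa using add_pos_of_nonneg_of_pos (hf.im_nonneg ⟨z, hz⟩) hε

theorem IsPick.norm_sub_le {f : ℂ → ℂ} (hf : IsPick f) (z w : ℍ) :
    ‖f z - f w‖ ≤ (f w).im * (Real.exp (dist z w) - 1) := by
  have hshift (ε : ℝ) (hε : 0 < ε) :
      ‖f z - f w‖ ≤ ((f w).im + ε) * (Real.exp (dist z w) - 1) := by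
    have hfε := hf.isAnalyticSelfMap_add hε
    calc ‖f z - f w‖ = dist (hfε.selfMap z : ℂ) (hfε.selfMap w) := by
          simp [IsAnalyticSelfMap.selfMap, dist_eq_norm]
      _ ≤ (hfε.selfMap w).im * (Real.exp (dist (hfε.selfMap z) (hfε.selfMap w)) - 1) :=
          dist_coe_le _ _
      _ ≤ (hfε.selfMap w).im * (Real.exp (dist z w) - 1) := by
          gcongr
          exact hfε.dist_selfMap_le z w
      _ = ((f w).im + ε) * (Real.exp (dist z w) - 1) := by
          simp [IsAnalyticSelfMap.selfMap, UpperHalfPlane.im]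
  have hlim : Tendsto (fun ε : ℝ => ((f w).im + ε) * (Real.exp (dist z w) - 1)) (𝓝[>] 0)
      (𝓝 (((f w).im + 0) * (Real.exp (dist z w) - 1))) :=
    tendsto_nhdsWithin_of_tendsto_nhds (Continuous.tendsto (by fun_prop) 0)
  rw [add_zero] at hlim
  exact ge_of_tendsto hlim (eventually_nhdsWithin_of_forall hshift)

theorem exp_dist_sub_one_le (z w : ℍ) :
    Real.exp (dist z w) - 1 ≤ 1 + ‖(z : ℂ) - w‖ ^ 2 / (z.im * w.im) := by
  have hcosh : Real.exp (dist z w) ≤ 2 * Real.cosh (dist z w) := by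
    linarith [Real.cosh_eq (dist z w), Real.exp_pos (-dist z w)]
  rw [cosh_dist, dist_eq_norm, mul_assoc, mul_comm 2 (_ * _), ← div_div] at hcosh
  linarith

/-! ### Cones at infinity -/

theorem mem_sector_iff {δ : ℝ} (hδ : 0 < δ) (hδ' : δ ≤ Real.pi / 2) {z : ℂ} :
    z ∈ sector δ ↔ Real.sin δ * ‖z‖ < z.im := by
  change |z.arg - Real.pi / 2| < Real.pi / 2 - δ ↔ _
  rcases eq_or_ne z 0 with rfl | hz
  · rw [Complex.arg_zero, zero_sub, abs_neg, abs_of_pos Real.pi_div_two_pos]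
    simp [hδ.le]
  rcases lt_or_ge z.im 0 with him | him
  · have harg : z.arg < 0 := Complex.arg_neg_iff.2 him
    have hsin : 0 ≤ Real.sin δ * ‖z‖ := by
      have := Real.sin_nonneg_of_nonneg_of_le_pi hδ.le (by linarith)
      positivity
    rw [abs_of_neg (by linarith [Real.pi_pos])]
    constructor <;> intro h <;> linarith
  · have harg : |z.arg - Real.pi / 2| ≤ Real.pi / 2 :=
      abs_le.2 ⟨by linarith [Complex.arg_nonneg_iff.2 him], by linarith [z.arg_le_pi]⟩
    have him_eq : z.im = Real.cos |z.arg - Real.pi / 2| * ‖z‖ := by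
      rw [Real.cos_abs, Real.cos_sub_pi_div_two, mul_comm, Complex.norm_mul_sin_arg]
    rw [him_eq, ← Real.cos_pi_div_two_sub, mul_lt_mul_iff_left₀ (norm_pos_iff.2 hz)]
    exact (Real.strictAntiOn_cos.lt_iff_gt ⟨by linarith, by linarith⟩
      ⟨abs_nonneg _, by linarith [Real.pi_pos]⟩).symm

/-- The filter of points tending to `∞` in the cone `{z | k * ‖z‖ < im z}`; for
`k = sin δ ∈ (0, 1)` this cone is `sector δ`. -/
noncomputable def coneAtInfty (k : ℝ) : Filter ℍ :=
  comap (↑) (Bornology.cobounded ℂ ⊓ 𝓟 {z : ℂ | k * ‖z‖ < z.im})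

theorem tendsto_coe_coneAtInfty (k : ℝ) :
    Tendsto ((↑) : ℍ → ℂ) (coneAtInfty k) (Bornology.cobounded ℂ) :=
  tendsto_comap.mono_right inf_le_left

theorem tendsto_norm_coneAtInfty (k : ℝ) :
    Tendsto (fun z : ℍ => ‖(z : ℂ)‖) (coneAtInfty k) atTop :=
  tendsto_norm_cobounded_atTop.comp (tendsto_coe_coneAtInfty k)

theorem eventually_lt_im_coneAtInfty (k : ℝ) :
    ∀ᶠ z : ℍ in coneAtInfty k, k * ‖(z : ℂ)‖ < z.im :=
  (tendsto_comap.mono_right inf_le_right).eventually (mem_principal_self _)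

theorem tendsto_coneAtInfty_iff {ι : Type*} {l : Filter ι} {u : ι → ℍ} {k : ℝ} :
    Tendsto u l (coneAtInfty k) ↔
      Tendsto (fun i => ‖(u i : ℂ)‖) l atTop ∧ ∀ᶠ i in l, k * ‖(u i : ℂ)‖ < (u i).im := by
  rw [coneAtInfty, tendsto_comap_iff, tendsto_inf, tendsto_principal,
    ← tendsto_norm_atTop_iff_cobounded]
  rfl

theorem nonTangentialLimit_iff {β : Type*} {f : ℂ → β} {l : Filter β} :
    NonTangentialLimit f l ↔ ∀ k > 0, Tendsto (fun z : ℍ => f z) (coneAtInfty k) l := by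
  have htendsto {k : ℝ} (hk : 0 < k) : Tendsto (fun z : ℍ => f z) (coneAtInfty k) l ↔
      Tendsto f (Bornology.cobounded ℂ ⊓ 𝓟 {z : ℂ | k * ‖z‖ < z.im}) l := by
    have hrange : Set.range ((↑) : ℍ → ℂ) ∈
        Bornology.cobounded ℂ ⊓ 𝓟 {z : ℂ | k * ‖z‖ < z.im} :=
      mem_inf_of_right fun z hz => ⟨⟨z, (by positivity : 0 ≤ k * ‖z‖).trans_lt hz⟩, rfl⟩
    rw [← map_comap_of_mem hrange, tendsto_map'_iff]
    rfl
  have hsector {δ : ℝ} (hδ : 0 < δ) (hδ' : δ ≤ Real.pi / 2) :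
      sector δ = {z : ℂ | Real.sin δ * ‖z‖ < z.im} :=
    Set.ext fun _ => mem_sector_iff hδ hδ'
  constructor
  · intro h k hk
    rw [htendsto hk]
    rcases lt_or_ge k 1 with hk' | hk'
    · rw [← Real.sin_arcsin (by linarith) hk'.le,
        ← hsector (Real.arcsin_pos.2 hk) (Real.arcsin_le_pi_div_two k)]
      exact h _ (Real.arcsin_pos.2 hk)
    · have hempty : {z : ℂ | k * ‖z‖ < z.im} = ∅ :=
        Set.eq_empty_of_forall_notMem fun z hz => hz.not_ge <|
          (Complex.im_le_norm z).trans (le_mul_of_one_le_left (norm_nonneg z) hk')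
      simp only [hempty, principal_empty, inf_bot_eq, tendsto_bot]
  · intro h δ hδ
    rcases le_or_gt δ (Real.pi / 2) with hδ' | hδ'
    · have hsin := Real.sin_pos_of_pos_of_lt_pi hδ (by linarith [Real.pi_pos])
      rw [hsector hδ hδ', ← htendsto hsin]
      exact h _ hsin
    · have hempty : sector δ = ∅ :=
        Set.eq_empty_of_forall_notMem fun z hz =>
          (abs_nonneg _).not_gt (lt_trans hz (sub_neg.2 hδ'))
      simp only [hempty, principal_empty, inf_bot_eq, tendsto_bot]

/-! ### The Julia–Wolff theorem -/

theorem IsPick.norm_le_of_norm_le {f : ℂ → ℂ} (hf : IsPick f) {k : ℝ} (hk : 0 < k) {z w : ℍ}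
    (hwz : ‖(w : ℂ)‖ ≤ ‖(z : ℂ)‖) (hz : k * ‖(z : ℂ)‖ < z.im) :
    ‖f z‖ ≤ 2 * ‖f w‖ + 4 / k * ((f w).im / w.im) * ‖(z : ℂ)‖ := by
  have hfw := hf.im_nonneg w
  have := w.im_pos
  have hz0 : 0 < ‖(z : ℂ)‖ := norm_pos_iff.2 z.ne_zero
  have hdist : ‖(z : ℂ) - w‖ ^ 2 ≤ (2 * ‖(z : ℂ)‖) ^ 2 := by
    have := _root_.norm_sub_le (z : ℂ) w
    gcongr
    linarith
  have hexp : Real.exp (dist z w) - 1 ≤ 1 + 4 / k * ‖(z : ℂ)‖ / w.im :=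
    calc Real.exp (dist z w) - 1 ≤ 1 + ‖(z : ℂ) - w‖ ^ 2 / (z.im * w.im) :=
          exp_dist_sub_one_le z w
      _ ≤ 1 + (2 * ‖(z : ℂ)‖) ^ 2 / (k * ‖(z : ℂ)‖ * w.im) := by gcongr
      _ = 1 + 4 / k * ‖(z : ℂ)‖ / w.im := by field_simp; ring
  calc ‖f z‖ ≤ ‖f w‖ + ‖f z - f w‖ := norm_le_norm_add_norm_sub' _ _
    _ ≤ ‖f w‖ + (f w).im * (1 + 4 / k * ‖(z : ℂ)‖ / w.im) := by
        grw [hf.norm_sub_le z w, hexp]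
    _ = ‖f w‖ + (f w).im + 4 / k * ((f w).im / w.im) * ‖(z : ℂ)‖ := by ring
    _ ≤ 2 * ‖f w‖ + 4 / k * ((f w).im / w.im) * ‖(z : ℂ)‖ := by
        linarith [Complex.im_le_norm (f w)]

theorem IsPick.tendsto_div_nhds_zero {f : ℂ → ℂ} (hf : IsPick f)
    (hinf : ∀ ε > 0, ∃ w : ℍ, (f w).im / w.im < ε) {k : ℝ} (hk : 0 < k) :
    Tendsto (fun z : ℍ => f z / z) (coneAtInfty k) (𝓝 0) := by
  rw [NormedAddGroup.tendsto_nhds_zero]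
  intro ε hε
  obtain ⟨w, hw⟩ := hinf (k / 4 * (ε / 2)) (by positivity)
  have hsmall : Tendsto (fun z : ℍ => 2 * ‖f w‖ / ‖(z : ℂ)‖) (coneAtInfty k) (𝓝 0) :=
    (tendsto_norm_coneAtInfty k).const_div_atTop _
  filter_upwards [(tendsto_norm_coneAtInfty k).eventually_ge_atTop ‖(w : ℂ)‖,
    eventually_lt_im_coneAtInfty k, hsmall.eventually_lt_const (half_pos hε)] with z hwz hz hz'
  have hz0 : 0 < ‖(z : ℂ)‖ := norm_pos_iff.2 z.ne_zero
  calc ‖f z / z‖ = ‖f z‖ / ‖(z : ℂ)‖ := norm_div _ _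
    _ ≤ (2 * ‖f w‖ + 4 / k * ((f w).im / w.im) * ‖(z : ℂ)‖) / ‖(z : ℂ)‖ := by
        grw [hf.norm_le_of_norm_le hk hwz hz]
    _ = 2 * ‖f w‖ / ‖(z : ℂ)‖ + 4 / k * ((f w).im / w.im) := by field_simp
    _ < ε / 2 + 4 / k * (k / 4 * (ε / 2)) := by gcongr
    _ = ε := by field_simp; ring

-- Julia–Wolff: subtracting `a * z` leaves a Pick function whose dilation is `0`.
theorem IsPick.tendsto_div_of_isGLB {f : ℂ → ℂ} (hf : IsPick f) {a : ℝ}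
    (ha : IsGLB ((fun z : ℂ => (f z).im / z.im) '' upperHalfPlaneSet) a) {k : ℝ} (hk : 0 < k) :
    Tendsto (fun z : ℍ => f z / z) (coneAtInfty k) (𝓝 (a : ℂ)) := by
  set g : ℂ → ℂ := fun z => f z - a * z
  have hg_im (z : ℍ) : (g z).im = (f z).im - a * z.im := by simp [g]
  have hg : IsPick g :=
    ⟨hf.differentiableOn.sub (by fun_prop), fun z => by
      rw [hg_im, sub_nonneg, ← le_div_iff₀ z.im_pos]
      exact ha.1 ⟨z, z.im_pos, rfl⟩⟩
  have hg_inf (ε : ℝ) (hε : 0 < ε) : ∃ w : ℍ, (g w).im / w.im < ε := by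
    obtain ⟨_, ⟨w, hw, rfl⟩, -, hlt⟩ := ha.exists_between (lt_add_of_pos_right a hε)
    refine ⟨⟨w, hw⟩, ?_⟩
    rw [hg_im, sub_div, mul_div_cancel_right₀ _ (im_ne_zero _)]
    exact sub_left_lt_of_lt_add hlt
  have hlim := (hg.tendsto_div_nhds_zero hg_inf hk).add_const (a : ℂ)
  rw [zero_add] at hlim
  refine hlim.congr fun z => ?_
  rw [sub_div, mul_div_cancel_right₀ _ z.ne_zero, sub_add_cancel]

theorem exists_tendsto_coneAtInfty_smul (z : ℍ) :
    ∃ k > 0, ∀ {ι : Type*} {l : Filter ι} {t : ι → {x : ℝ // 0 < x}},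
      Tendsto (fun i => (t i : ℝ)) l atTop → Tendsto (fun i => t i • z) l (coneAtInfty k) := by
  have hz0 : 0 < ‖(z : ℂ)‖ := norm_pos_iff.2 z.ne_zero
  refine ⟨z.im / (2 * ‖(z : ℂ)‖), div_pos z.im_pos (by positivity), fun {ι l t} ht => ?_⟩
  have hnorm (i : ι) : ‖((t i • z : ℍ) : ℂ)‖ = t i * ‖(z : ℂ)‖ := by
    simp [UpperHalfPlane.coe_pos_real_smul, abs_of_pos (t i).2]
  simp only [tendsto_coneAtInfty_iff, hnorm, pos_real_im]
  refine ⟨ht.atTop_mul_const hz0, .of_forall fun i => ?_⟩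
  have := (t i).2
  have := z.im_pos
  rw [div_mul_eq_mul_div, div_lt_iff₀ (by positivity)]
  nlinarith [mul_pos (mul_pos (t i).2 z.im_pos) hz0]

theorem IsPick.exists_eq_mul_of_map_smul {f : ℂ → ℂ} (hf : IsPick f) {A : {x : ℝ // 0 < x}}
    (hA : 1 < (A : ℝ)) (hfA : ∀ z : ℍ, f (A • z : ℍ) = A * f z) :
    ∃ a : ℝ, ∀ z : ℍ, f z = a * z := by
  set S : Set ℝ := (fun z : ℂ => (f z).im / z.im) '' upperHalfPlaneSet
  have hS : IsGLB S (sInf S) := by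
    refine isGLB_csInf ⟨_, I, I.im_pos, rfl⟩ ⟨0, ?_⟩
    rintro _ ⟨z, hz, rfl⟩
    exact div_nonneg (hf.im_nonneg ⟨z, hz⟩) (le_of_lt hz)
  refine ⟨sInf S, fun z => ?_⟩
  have hiter (n : ℕ) : f (A ^ n • z : ℍ) / (A ^ n • z : ℍ) = f z / z := by
    induction n with
    | zero => simp
    | succ n ih =>
      rw [← ih, pow_succ', mul_smul, hfA, coe_pos_real_smul A, Complex.real_smul,
        mul_div_mul_left _ _ (Complex.ofReal_ne_zero.2 A.2.ne')]
  obtain ⟨k, hk, hsmul⟩ := exists_tendsto_coneAtInfty_smul z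
  have hlim := (hf.tendsto_div_of_isGLB hS hk).comp
    (hsmul (t := fun n : ℕ => A ^ n) (by simpa using tendsto_pow_atTop_atTop_of_one_lt hA))
  simp only [Function.comp_def, hiter] at hlim
  exact (div_eq_iff z.ne_zero).1 (tendsto_nhds_unique tendsto_const_nhds hlim)

theorem IsHyperbolicType.mul_im_le {Φ : ℂ → ℂ} {A : ℝ} (hΦ : IsHyperbolicType Φ A) (z : ℍ) :
    A * z.im ≤ (hΦ.1.selfMap z).im :=
  (le_div_iff₀ z.im_pos).1 (hΦ.2.2.1 ⟨z, z.im_pos, rfl⟩)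

theorem IsHyperbolicType.tendsto_dist_selfMap_smul {Φ : ℂ → ℂ} {A : {x : ℝ // 0 < x}}
    (hΦ : IsHyperbolicType Φ A) {k : ℝ} (hk : 0 < k) :
    Tendsto (fun z : ℍ => dist (A • z) (hΦ.1.selfMap z)) (coneAtInfty k) (𝓝 0) := by
  have hA := A.2
  have hratio : Tendsto (fun z : ℍ => ‖Φ z / z - (A : ℝ)‖ / (A * k)) (coneAtInfty k) (𝓝 0) := by
    simpa using ((tendsto_iff_norm_sub_tendsto_zero.1
      (hΦ.1.isPick.tendsto_div_of_isGLB hΦ.2.2 hk)).div_const (A * k : ℝ))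
  refine squeeze_zero' (.of_forall fun _ => dist_nonneg) ?_ hratio
  filter_upwards [eventually_lt_im_coneAtInfty k] with z hz
  have hz0 : 0 < ‖(z : ℂ)‖ := norm_pos_iff.2 z.ne_zero
  have hsqrt : A * (k * ‖(z : ℂ)‖) ≤ √((A • z).im * (hΦ.1.selfMap z).im) := by
    refine Real.le_sqrt_of_sq_le ?_
    rw [pos_real_im, sq]
    have := z.im_pos
    grw [← hΦ.mul_im_le z]
    gcongr
  have hnorm : dist ((A • z : ℍ) : ℂ) (hΦ.1.selfMap z) = ‖Φ z / z - (A : ℝ)‖ * ‖(z : ℂ)‖ := by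
    rw [dist_comm, dist_eq_norm, ← norm_mul, sub_mul, div_mul_cancel₀ _ z.ne_zero]
    simp [IsAnalyticSelfMap.selfMap]
  calc dist (A • z) (hΦ.1.selfMap z) ≤
        dist ((A • z : ℍ) : ℂ) (hΦ.1.selfMap z) / √((A • z).im * (hΦ.1.selfMap z).im) :=
        dist_le_dist_coe_div_sqrt _ _
    _ ≤ ‖Φ z / z - (A : ℝ)‖ * ‖(z : ℂ)‖ / (A * (k * ‖(z : ℂ)‖)) := by rw [hnorm]; gcongr
    _ = ‖Φ z / z - (A : ℝ)‖ / (A * k) := by field_simp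

theorem Intertwines.tendsto_map_smul_div {σ Φ : ℂ → ℂ} {A : {x : ℝ // 0 < x}}
    (hσΦ : Intertwines σ Φ A) (hΦ : IsHyperbolicType Φ A) (hσ : IsAnalyticSelfMap σ)
    {k : ℝ} (hk : 0 < k) :
    Tendsto (fun z : ℍ => σ (A • z : ℍ) / σ z) (coneAtInfty k) (𝓝 (A : ℝ)) := by
  have hexp : Tendsto
      (fun z : ℍ => (A : ℝ) * (Real.exp (dist (A • z) (hΦ.1.selfMap z)) - 1))
      (coneAtInfty k) (𝓝 0) := by
    simpa using (((Real.continuous_exp.tendsto 0).comp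
      (hΦ.tendsto_dist_selfMap_smul hk)).sub_const 1).const_mul (A : ℝ)
  rw [tendsto_iff_norm_sub_tendsto_zero]
  refine squeeze_zero (fun _ => norm_nonneg _) (fun z => ?_) hexp
  have hσz : σ z ≠ 0 := (hσ.selfMap z).ne_zero
  have hσΦz : σ (hΦ.1.selfMap z) = (A : ℝ) * σ z := hσΦ z z.im_pos
  have hnorm : ‖σ (hΦ.1.selfMap z)‖ = A * ‖σ z‖ := by
    rw [hσΦz, norm_mul, Complex.norm_real, Real.norm_of_nonneg A.2.le]
  have hdist : 0 ≤ Real.exp (dist (A • z) (hΦ.1.selfMap z)) - 1 :=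
    sub_nonneg.2 (Real.one_le_exp dist_nonneg)
  rw [← mul_div_cancel_right₀ ((A : ℝ) : ℂ) hσz, ← hσΦz, ← sub_div, norm_div,
    div_le_iff₀ (norm_pos_iff.2 hσz)]
  grw [hσ.isPick.norm_sub_le (A • z) (hΦ.1.selfMap z), Complex.im_le_norm, hnorm]
  exact le_of_eq (by ring)

/-! ### Normal families of Pick functions -/

theorem IsPick.norm_le_mul_exp_dist {f : ℂ → ℂ} (hf : IsPick f) (z w : ℍ) :
    ‖f z‖ ≤ ‖f w‖ * Real.exp (dist z w) := by
  have hexp : 0 ≤ Real.exp (dist z w) - 1 := sub_nonneg.2 (Real.one_le_exp dist_nonneg)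
  calc ‖f z‖ ≤ ‖f w‖ + ‖f z - f w‖ := norm_le_norm_add_norm_sub' _ _
    _ ≤ ‖f w‖ + ‖f w‖ * (Real.exp (dist z w) - 1) := by
        grw [hf.norm_sub_le z w, Complex.im_le_norm]
    _ = ‖f w‖ * Real.exp (dist z w) := by ring

section NormalFamily

variable {ι : Type*} {F : ι → ℂ → ℂ} {f : ℂ → ℂ}

theorem tendsto_exp_dist_sub_one (w : ℍ) :
    Tendsto (fun z : ℍ => Real.exp (dist z w) - 1) (𝓝 w) (𝓝 0) := by
  have : Continuous fun z : ℍ => Real.exp (dist z w) - 1 := by fun_prop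
  simpa using this.tendsto w

theorem IsPick.tendstoLocallyUniformlyOn {l : Filter ι} (hF : ∀ i, IsPick (F i))
    (hlim : ∀ z : ℍ, Tendsto (fun i => F i z) l (𝓝 (f z))) :
    TendstoLocallyUniformlyOn F f l upperHalfPlaneSet := by
  rcases l.eq_or_neBot with rfl | _
  · exact fun u _ x _ => ⟨Set.univ, univ_mem, eventually_bot⟩
  have him (w : ℍ) : Tendsto (fun i => (F i w).im) l (𝓝 (f w).im) :=
    (Complex.continuous_im.tendsto _).comp (hlim w)
  have hf (z w : ℍ) : ‖f z - f w‖ ≤ (f w).im * (Real.exp (dist z w) - 1) :=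
    le_of_tendsto_of_tendsto' ((hlim z).sub (hlim w)).norm ((him w).mul_const _)
      fun i => (hF i).norm_sub_le z w
  rw [Metric.tendstoLocallyUniformlyOn_iff]
  intro ε hε w hw
  lift w to ℍ using hw
  have hsmall : ∀ᶠ z in 𝓝 w,
      (f w).im * (Real.exp (dist z w) - 1) + ((f w).im + 1) * (Real.exp (dist z w) - 1) <
        ε / 2 := by
    refine Tendsto.eventually_lt_const (v := 0) (half_pos hε) ?_
    simpa using ((tendsto_exp_dist_sub_one w).const_mul (f w).im).add
      ((tendsto_exp_dist_sub_one w).const_mul ((f w).im + 1))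
  refine ⟨_, mem_nhdsWithin_of_mem_nhds (isOpenEmbedding_coe.image_mem_nhds.2 hsmall), ?_⟩
  filter_upwards [Metric.tendsto_nhds.1 (hlim w) _ (half_pos hε),
    (him w).eventually_le_const (lt_add_one _)] with i hi hi'
  rintro _ ⟨z, hz, rfl⟩
  have hexp : 0 ≤ Real.exp (dist z w) - 1 := sub_nonneg.2 (Real.one_le_exp dist_nonneg)
  calc dist (f z) (F i z) ≤ dist (f z) (f w) + dist (f w) (F i w) + dist (F i w) (F i z) :=
        dist_triangle4 _ _ _ _
    _ = ‖f z - f w‖ + ‖F i z - F i w‖ + dist (F i w) (f w) := by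
        rw [dist_eq_norm, dist_comm (F i w) (F i z), dist_eq_norm (F i z), dist_comm (f w)]
        ring
    _ ≤ (f w).im * (Real.exp (dist z w) - 1) + ((f w).im + 1) * (Real.exp (dist z w) - 1) +
          dist (F i w) (f w) := by
        grw [hf z w, (hF i).norm_sub_le z w, hi']
    _ < ε := by linarith [hz.out]

theorem IsPick.of_tendsto {l : Filter ι} [l.NeBot] (hF : ∀ i, IsPick (F i))
    (hlim : ∀ z : ℍ, Tendsto (fun i => F i z) l (𝓝 (f z))) : IsPick f where
  differentiableOn := (IsPick.tendstoLocallyUniformlyOn hF hlim).differentiableOn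
    (.of_forall fun i => (hF i).differentiableOn) isOpen_upperHalfPlaneSet
  im_nonneg z := ge_of_tendsto' ((Complex.continuous_im.tendsto _).comp (hlim z))
    fun i => (hF i).im_nonneg z

theorem IsPick.exists_tendsto_ultrafilter (hF : ∀ i, IsPick (F i)) {w : ℍ} {C : ℝ}
    (hC : ∀ i, ‖F i w‖ ≤ C) (l : Ultrafilter ι) :
    ∃ f : ℂ → ℂ, IsPick f ∧ ∀ z : ℍ, Tendsto (fun i => F i z) l (𝓝 (f z)) := by
  have hpoint (z : ℍ) : ∃ c, Tendsto (fun i => F i z) l (𝓝 c) := by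
    have hbound : ∀ i, F i z ∈ Metric.closedBall 0 (C * Real.exp (dist z w)) := fun i => by
      rw [mem_closedBall_zero_iff]
      grw [(hF i).norm_le_mul_exp_dist z w, hC i]
    obtain ⟨c, -, hc⟩ := (isCompact_closedBall _ _).ultrafilter_le_nhds
      (l.map fun i => F i z) (tendsto_principal.2 (.of_forall hbound))
    exact ⟨c, hc⟩
  choose g hg using hpoint
  have hlim (z : ℍ) : Tendsto (fun i => F i z) l (𝓝 (g (ofComplex z))) := by
    rw [ofComplex_apply]
    exact hg z
  exact ⟨fun ζ => g (ofComplex ζ), .of_tendsto hF hlim, hlim⟩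

theorem IsPick.tendsto_id_of_tendsto_map_smul_div {l : Filter ι} (hF : ∀ i, IsPick (F i))
    (hnorm : ∀ i, ‖F i I‖ = 1) {A : {x : ℝ // 0 < x}} (hA : 1 < (A : ℝ))
    (hdiv : ∀ z : ℍ, Tendsto (fun i => F i (A • z : ℍ) / F i z) l (𝓝 (A : ℝ))) (z : ℍ) :
    Tendsto (fun i => F i z) l (𝓝 z) := by
  rw [tendsto_iff_ultrafilter]
  intro u hu
  obtain ⟨f, hf, hlim⟩ := IsPick.exists_tendsto_ultrafilter hF (fun i => (hnorm i).le) u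
  have hfA (w : ℍ) : f (A • w : ℍ) = A * f w := by
    have hdiv' := (hdiv w).mono_left hu
    refine tendsto_nhds_unique ((hlim (A • w)).congr' ?_) (hdiv'.mul (hlim w))
    filter_upwards [hdiv'.eventually_ne (Complex.ofReal_ne_zero.2 A.2.ne')] with i hi
    rw [div_mul_cancel₀ _ (div_ne_zero_iff.1 hi).2]
  obtain ⟨a, ha⟩ := hf.exists_eq_mul_of_map_smul hA hfA
  have ha_one : a = 1 := by
    have ha_nonneg : 0 ≤ (f I).im := hf.im_nonneg I
    have ha_norm : ‖f I‖ = 1 :=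
      tendsto_nhds_unique (hlim I).norm (by simp only [hnorm, tendsto_const_nhds])
    rw [ha, coe_I, Complex.im_ofReal_mul, Complex.I_im, mul_one] at ha_nonneg
    rwa [ha, coe_I, norm_mul, Complex.norm_I, mul_one, Complex.norm_of_nonneg ha_nonneg] at ha_norm
  simpa [ha, ha_one] using hlim z

end NormalFamily

/-! ### Blow-downs at infinity -/

theorem pow_mul_le_of_mul_le_map_mul {g : ℝ → ℝ} {A c m t₀ : ℝ} (hA : 1 < A) (hc : 1 ≤ c)
    (hm : 0 ≤ m) (ht₀ : 0 < t₀) (hbase : ∀ s ∈ Set.Icc t₀ (A * t₀), m ≤ g s)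
    (hstep : ∀ s, t₀ ≤ s → c * g s ≤ g (A * s)) (N : ℕ) {t : ℝ} (ht : A ^ N * t₀ ≤ t) :
    c ^ N * m ≤ g t := by
  have hiter (n : ℕ) (s : ℝ) (hs : s ∈ Set.Icc t₀ (A * t₀)) : c ^ n * m ≤ g (A ^ n * s) := by
    induction n with
    | zero => simpa using hbase s hs
    | succ n ih =>
      have hle : t₀ ≤ A ^ n * s :=
        hs.1.trans (le_mul_of_one_le_left (ht₀.trans_le hs.1).le (one_le_pow₀ hA.le))
      calc c ^ (n + 1) * m = c * (c ^ n * m) := by ring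
        _ ≤ c * g (A ^ n * s) := by gcongr
        _ ≤ g (A * (A ^ n * s)) := hstep _ hle
        _ = g (A ^ (n + 1) * s) := by rw [pow_succ', mul_assoc]
  have hNt : A ^ N ≤ t / t₀ := (le_div_iff₀ ht₀).2 ht
  obtain ⟨n, hn, hn'⟩ := exists_nat_pow_near ((one_le_pow₀ hA.le).trans hNt) hA
  have hNn : N ≤ n := Nat.lt_succ_iff.1 ((pow_lt_pow_iff_right₀ hA).1 (hNt.trans_lt hn'))
  have hAn : 0 < A ^ n := pow_pos (one_pos.trans hA) n
  have hs : t / A ^ n ∈ Set.Icc t₀ (A * t₀) := by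
    rw [le_div_iff₀ ht₀] at hn
    rw [div_lt_iff₀ ht₀, pow_succ] at hn'
    exact ⟨(le_div_iff₀ hAn).2 (by linarith), (div_le_iff₀ hAn).2 (by linarith)⟩
  calc c ^ N * m ≤ c ^ n * m := by gcongr
    _ ≤ g (A ^ n * (t / A ^ n)) := hiter n _ hs
    _ = g t := by rw [mul_div_cancel₀ _ hAn.ne']

theorem tendsto_atTop_of_tendsto_map_mul_div {g : ℝ → ℝ} {A L : ℝ} (hA : 1 < A) (hL : 1 < L)
    (hg : ContinuousOn g (Set.Ioi 0)) (hpos : ∀ t, 0 < t → 0 < g t)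
    (hlim : Tendsto (fun t => g (A * t) / g t) atTop (𝓝 L)) : Tendsto g atTop atTop := by
  obtain ⟨c, hc, hcL⟩ := exists_between hL
  obtain ⟨t₀, ht₀⟩ := eventually_atTop.1
    ((hlim.eventually_const_le hcL).and (eventually_gt_atTop 0))
  have ht₀_pos : 0 < t₀ := (ht₀ t₀ le_rfl).2
  have hstep (t : ℝ) (ht : t₀ ≤ t) : c * g t ≤ g (A * t) :=
    (le_div_iff₀ (hpos t (ht₀ t ht).2)).1 (ht₀ t ht).1
  obtain ⟨s₀, hs₀, hmin⟩ := (isCompact_Icc (a := t₀) (b := A * t₀)).exists_isMinOn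
    ⟨t₀, le_rfl, le_mul_of_one_le_left ht₀_pos.le hA.le⟩
    (hg.mono fun s hs => ht₀_pos.trans_le hs.1)
  have hm : 0 < g s₀ := hpos s₀ (ht₀_pos.trans_le hs₀.1)
  refine tendsto_atTop.2 fun R => ?_
  obtain ⟨N, hN⟩ := (((tendsto_pow_atTop_atTop_of_one_lt hc).atTop_mul_const
    hm).eventually_ge_atTop R).exists
  filter_upwards [eventually_ge_atTop (A ^ N * t₀)] with t ht
  exact hN.trans (pow_mul_le_of_mul_le_map_mul hA hc.le hm.le ht₀_pos hmin hstep N ht)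

/-- The blow-down of `f` at `∞` at scale `t`, normalised to have modulus `1` at `i`. -/
noncomputable def blowDown (f : ℂ → ℂ) (t : ℝ) (z : ℂ) : ℂ :=
  f (t * z) / ‖f (t * Complex.I)‖

theorem IsAnalyticSelfMap.isPick_blowDown {f : ℂ → ℂ} (hf : IsAnalyticSelfMap f) {t : ℝ}
    (ht : 0 < t) : IsPick (blowDown f t) := by
  have hmaps : Set.MapsTo (fun z : ℂ => (t : ℂ) * z) upperHalfPlaneSet upperHalfPlaneSet :=
    fun z hz => by simpa using mul_pos ht hz
  refine ⟨(hf.1.differentiableOn.comp (by fun_prop) hmaps).div_const _, fun z => ?_⟩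
  rw [blowDown, Complex.div_ofReal_im]
  exact div_nonneg (hf.2 (hmaps z.im_pos)).le (norm_nonneg _)

theorem tendstoLocallyUniformlyOn_blowDown {σ : ℂ → ℂ} (hσ : IsAnalyticSelfMap σ)
    {A : {x : ℝ // 0 < x}} (hA : 1 < (A : ℝ))
    (hdiv : ∀ k > 0, Tendsto (fun z : ℍ => σ (A • z : ℍ) / σ z) (coneAtInfty k) (𝓝 (A : ℝ)))
    {ι : Type*} {l : Filter ι} {t : ι → ℝ} (ht_pos : ∀ i, 0 < t i) (ht : Tendsto t l atTop) :
    TendstoLocallyUniformlyOn (fun i => blowDown σ (t i)) id l upperHalfPlaneSet := by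
  have hpick (i : ι) : IsPick (blowDown σ (t i)) := hσ.isPick_blowDown (ht_pos i)
  have hne (i : ι) (z : ℍ) : σ (t i * z) ≠ 0 :=
    (hσ.selfMap ((⟨t i, ht_pos i⟩ : {x : ℝ // 0 < x}) • z)).ne_zero
  refine IsPick.tendstoLocallyUniformlyOn hpick
    (IsPick.tendsto_id_of_tendsto_map_smul_div hpick (fun i => ?_) hA fun z => ?_)
  · rw [blowDown, coe_I, norm_div, Complex.norm_real, norm_norm]
    exact div_self (norm_ne_zero_iff.2 (hne i I))
  · obtain ⟨k, hk, hsmul⟩ := exists_tendsto_coneAtInfty_smul z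
    refine ((hdiv k hk).comp (hsmul (t := fun i => ⟨t i, ht_pos i⟩) ht)).congr fun i => ?_
    have hnorm := Complex.ofReal_ne_zero.2 (norm_ne_zero_iff.2 (hne i I))
    simp only [coe_I] at hnorm
    simp only [Function.comp_apply, blowDown, coe_pos_real_smul, Complex.real_smul,
      div_div_div_cancel_right₀ hnorm, mul_left_comm]

theorem isCompact_cone_inter_sphere (k : ℝ) :
    IsCompact {z : ℂ | ‖z‖ = 1 ∧ k ≤ z.im} := by
  have hclosed : IsClosed {z : ℂ | k ≤ z.im} := isClosed_le continuous_const Complex.continuous_im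
  convert (isCompact_sphere (0 : ℂ) 1).inter_right hclosed using 1
  ext z
  simp

/-- The factor that makes `f z / z` close to `1` for `z` in a cone at `∞`; it compares `f` with the
identity at the point `i ‖z‖` of modulus `‖z‖`. -/
noncomputable def radialScale (f : ℂ → ℂ) (z : ℍ) : ℝ :=
  ‖(z : ℂ)‖ / ‖f (‖(z : ℂ)‖ * Complex.I)‖

theorem IsAnalyticSelfMap.radialScale_pos {f : ℂ → ℂ} (hf : IsAnalyticSelfMap f) (z : ℍ) :
    0 < radialScale f z :=
  div_pos (norm_pos_iff.2 z.ne_zero) (hf.norm_map_mul_I_pos (norm_pos_iff.2 z.ne_zero))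

theorem tendsto_radialScale_mul_div_of_blowDown {σ : ℂ → ℂ} {k : ℝ} (hk : 0 < k)
    (hblow : TendstoLocallyUniformlyOn (fun z : ℍ => blowDown σ ‖(z : ℂ)‖) id (coneAtInfty k)
      upperHalfPlaneSet) :
    Tendsto (fun z : ℍ => (radialScale σ z : ℂ) * (σ z / z)) (coneAtInfty k) (𝓝 1) := by
  have hunif := (tendstoLocallyUniformlyOn_iff_forall_isCompact isOpen_upperHalfPlaneSet).1 hblow
    {z : ℂ | ‖z‖ = 1 ∧ k ≤ z.im} (fun z hz => hk.trans_le hz.2) (isCompact_cone_inter_sphere k)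
  rw [Metric.tendsto_nhds]
  intro ε hε
  filter_upwards [Metric.tendstoUniformlyOn_iff.1 hunif ε hε, eventually_lt_im_coneAtInfty k]
    with z hz hkz
  have hz0 : 0 < ‖(z : ℂ)‖ := norm_pos_iff.2 z.ne_zero
  have hzC : ((‖(z : ℂ)‖ : ℝ) : ℂ) ≠ 0 := Complex.ofReal_ne_zero.2 hz0.ne'
  have hmem : (z : ℂ) / ‖(z : ℂ)‖ ∈ {z : ℂ | ‖z‖ = 1 ∧ k ≤ z.im} := by
    refine ⟨by simp [hz0.ne'], ?_⟩
    rw [Complex.div_ofReal_im, le_div_iff₀ hz0]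
    exact hkz.le
  have hdist := hz _ hmem
  rw [id_def, blowDown, mul_div_cancel₀ _ hzC, dist_comm, dist_eq_norm] at hdist
  rw [dist_eq_norm]
  convert hdist using 1
  have hfactor : σ z / ‖σ (‖(z : ℂ)‖ * Complex.I)‖ - z / ‖(z : ℂ)‖ =
      z / ‖(z : ℂ)‖ * ((radialScale σ z : ℂ) * (σ z / z) - 1) := by
    have := z.ne_zero
    rw [radialScale]
    push_cast
    field_simp
  rw [hfactor, norm_mul, hmem.1, one_mul]

theorem tendsto_arg_of_tendsto_real_mul {ι : Type*} {l : Filter ι} {r : ι → ℝ} {f : ι → ℂ}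
    (hr : ∀ i, 0 < r i) (hlim : Tendsto (fun i => (r i : ℂ) * f i) l (𝓝 1)) :
    Tendsto (fun i => (f i).arg) l (𝓝 0) := by
  have harg := (Complex.continuousAt_arg Complex.one_mem_slitPlane).tendsto.comp hlim
  rw [Complex.arg_one] at harg
  exact harg.congr fun i => Complex.arg_real_mul _ (hr i)

namespace Intertwines

variable {σ Φ : ℂ → ℂ} {A : {x : ℝ // 0 < x}}

theorem tendsto_radialScale_mul_div (hσΦ : Intertwines σ Φ A) (hΦ : IsHyperbolicType Φ A)
    (hσ : IsAnalyticSelfMap σ) {k : ℝ} (hk : 0 < k) :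
    Tendsto (fun z : ℍ => (radialScale σ z : ℂ) * (σ z / z)) (coneAtInfty k) (𝓝 1) :=
  tendsto_radialScale_mul_div_of_blowDown hk <| tendstoLocallyUniformlyOn_blowDown hσ hΦ.2.1
    (fun _ => hσΦ.tendsto_map_smul_div hΦ hσ) (fun z => norm_pos_iff.2 z.ne_zero)
    (tendsto_norm_coneAtInfty k)

theorem tendsto_arg_div (hσΦ : Intertwines σ Φ A) (hΦ : IsHyperbolicType Φ A)
    (hσ : IsAnalyticSelfMap σ) {k : ℝ} (hk : 0 < k) :
    Tendsto (fun z : ℍ => (σ z / z).arg) (coneAtInfty k) (𝓝 0) :=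
  tendsto_arg_of_tendsto_real_mul hσ.radialScale_pos (hσΦ.tendsto_radialScale_mul_div hΦ hσ hk)

theorem tendsto_norm_map_mul_I (hσΦ : Intertwines σ Φ A) (hΦ : IsHyperbolicType Φ A)
    (hσ : IsAnalyticSelfMap σ) : Tendsto (fun t : ℝ => ‖σ (t * Complex.I)‖) atTop atTop := by
  have hcont : ContinuousOn (fun t : ℝ => ‖σ (t * Complex.I)‖) (Set.Ioi 0) :=
    (hσ.1.continuousOn.comp (by fun_prop) fun t ht => by simpa using ht).norm
  refine tendsto_atTop_of_tendsto_map_mul_div hΦ.2.1 hΦ.2.1 hcont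
    (fun t ht => hσ.norm_map_mul_I_pos ht) ?_
  obtain ⟨k, hk, hsmul⟩ := exists_tendsto_coneAtInfty_smul I
  have hray := hsmul (t := fun t : Set.Ioi (0 : ℝ) => ⟨t, t.2⟩)
    (tendsto_comp_val_Ioi_atTop.2 tendsto_id)
  have hlim := ((hσΦ.tendsto_map_smul_div hΦ hσ hk).comp hray).norm
  rw [Complex.norm_of_nonneg A.2.le] at hlim
  rw [← tendsto_comp_val_Ioi_atTop (a := (0 : ℝ))]
  refine hlim.congr fun t => ?_
  simp [mul_assoc]

theorem tendsto_cobounded (hσΦ : Intertwines σ Φ A) (hΦ : IsHyperbolicType Φ A)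
    (hσ : IsAnalyticSelfMap σ) {k : ℝ} (hk : 0 < k) :
    Tendsto (fun z : ℍ => σ z) (coneAtInfty k) (Bornology.cobounded ℂ) := by
  rw [← tendsto_norm_atTop_iff_cobounded]
  have hlim := (hσΦ.tendsto_radialScale_mul_div hΦ hσ hk).norm
  rw [norm_one] at hlim
  have hradial := (hσΦ.tendsto_norm_map_mul_I hΦ hσ).comp (tendsto_norm_coneAtInfty k)
  refine (hlim.pos_mul_atTop one_pos hradial).congr fun z => ?_
  have hz : ‖(z : ℂ)‖ ≠ 0 := norm_ne_zero_iff.2 z.ne_zero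
  have hσz := (hσ.norm_map_mul_I_pos (norm_pos_iff.2 z.ne_zero)).ne'
  rw [Function.comp_apply, radialScale, norm_mul, norm_div, Complex.norm_real, norm_div,
    norm_norm, norm_norm]
  field_simp

theorem map_iterate (hσΦ : Intertwines σ Φ A) (hΦ : IsAnalyticSelfMap Φ) (n : ℕ) (z : ℍ) :
    σ (hΦ.selfMap^[n] z) = (A : ℝ) ^ n * σ z := by
  induction n with
  | zero => simp
  | succ n ih =>
    rw [Function.iterate_succ_apply', pow_succ', mul_assoc, ← ih]
    exact hσΦ _ (im_pos _)

end Intertwines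

/-! ### Orbits and uniqueness -/

theorem IsAnalyticSelfMap.norm_iterate_succ_sub_le {f : ℂ → ℂ} (hf : IsAnalyticSelfMap f) (z : ℍ)
    (n : ℕ) : ‖(hf.selfMap^[n + 1] z : ℂ) - hf.selfMap^[n] z‖ ≤
      (hf.selfMap^[n] z).im * (Real.exp (dist (hf.selfMap z) z) - 1) := by
  have hlip : LipschitzWith 1 hf.selfMap^[n] := by
    simpa using (LipschitzWith.mk_one hf.dist_selfMap_le).iterate n
  have hdist : dist (hf.selfMap^[n + 1] z) (hf.selfMap^[n] z) ≤ dist (hf.selfMap z) z := by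
    simpa using hlip.dist_le_mul (hf.selfMap z) z
  have := (hf.selfMap^[n] z).im_pos
  grw [← dist_eq_norm, dist_coe_le, hdist]

namespace IsHyperbolicType

variable {Φ : ℂ → ℂ} {A : ℝ}

theorem pow_mul_im_le (hΦ : IsHyperbolicType Φ A) (z : ℍ) (n : ℕ) :
    A ^ n * z.im ≤ (hΦ.1.selfMap^[n] z).im := by
  have hA : 0 < A := one_pos.trans hΦ.2.1
  induction n with
  | zero => simp
  | succ n ih =>
    rw [Function.iterate_succ_apply', pow_succ', mul_assoc]
    grw [ih, hΦ.mul_im_le]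

theorem exists_norm_iterate_le (hΦ : IsHyperbolicType Φ A) (z : ℍ) :
    ∃ M > 0, ∀ n : ℕ, ‖(hΦ.1.selfMap^[n] z : ℂ)‖ ≤ M * (hΦ.1.selfMap^[n] z).im := by
  have hA : 0 < A - 1 := sub_pos.2 hΦ.2.1
  set C := Real.exp (dist (hΦ.1.selfMap z) z) - 1
  set M := max (‖(z : ℂ)‖ / z.im) (C / (A - 1))
  have hM : 0 < M := lt_max_of_lt_left (div_pos (norm_pos_iff.2 z.ne_zero) z.im_pos)
  have hMC : C ≤ M * (A - 1) := (div_le_iff₀ hA).1 (le_max_right _ _)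
  refine ⟨M, hM, fun n => ?_⟩
  induction n with
  | zero => exact (div_le_iff₀ z.im_pos).1 (le_max_left _ _)
  | succ n ih =>
    set w := hΦ.1.selfMap^[n] z
    have him : A * w.im ≤ (hΦ.1.selfMap^[n + 1] z).im := by
      rw [Function.iterate_succ_apply']
      exact hΦ.mul_im_le w
    have := w.im_pos
    calc ‖(hΦ.1.selfMap^[n + 1] z : ℂ)‖
        ≤ ‖(w : ℂ)‖ + ‖(hΦ.1.selfMap^[n + 1] z : ℂ) - w‖ := norm_le_norm_add_norm_sub' _ _
      _ ≤ M * w.im + w.im * C := by grw [ih, hΦ.1.norm_iterate_succ_sub_le z n]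
      _ ≤ M * w.im + w.im * (M * (A - 1)) := by gcongr
      _ = M * (A * w.im) := by ring
      _ ≤ M * (hΦ.1.selfMap^[n + 1] z).im := by gcongr

theorem exists_tendsto_iterate_coneAtInfty (hΦ : IsHyperbolicType Φ A) (z : ℍ) :
    ∃ k > 0, Tendsto (fun n : ℕ => hΦ.1.selfMap^[n] z) atTop (coneAtInfty k) := by
  obtain ⟨M, hM, hle⟩ := hΦ.exists_norm_iterate_le z
  refine ⟨(2 * M)⁻¹, by positivity, tendsto_coneAtInfty_iff.2 ⟨?_, .of_forall fun n => ?_⟩⟩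
  · refine tendsto_atTop_mono (fun n => (hΦ.pow_mul_im_le z n).trans ?_)
      ((tendsto_pow_atTop_atTop_of_one_lt hΦ.2.1).atTop_mul_const z.im_pos)
    exact Complex.im_le_norm _
  · rw [inv_mul_lt_iff₀ (by positivity)]
    nlinarith [hle n, mul_pos hM (hΦ.1.selfMap^[n] z).im_pos]

end IsHyperbolicType

theorem IsPick.eq_of_im_eq_zero {f : ℂ → ℂ} (hf : IsPick f) {w : ℍ} (hw : (f w).im = 0) (z : ℍ) :
    f z = f w := by
  simpa [hw, sub_eq_zero] using hf.norm_sub_le z w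

theorem Intertwines.arg_div_eq_zero {σ σ' Φ : ℂ → ℂ} {A : {x : ℝ // 0 < x}}
    (hσΦ : Intertwines σ Φ A) (hσ'Φ : Intertwines σ' Φ A) (hΦ : IsHyperbolicType Φ A)
    (hσ : IsAnalyticSelfMap σ) (hσ' : IsAnalyticSelfMap σ') (z : ℍ) : (σ' z / σ z).arg = 0 := by
  set u : ℕ → ℍ := fun n => hΦ.1.selfMap^[n] z
  obtain ⟨k, hk, horbit⟩ := hΦ.exists_tendsto_iterate_coneAtInfty z
  have hlim := ((hσ'Φ.tendsto_radialScale_mul_div hΦ hσ' hk).comp horbit).div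
    ((hσΦ.tendsto_radialScale_mul_div hΦ hσ hk).comp horbit) one_ne_zero
  rw [div_one] at hlim
  refine tendsto_nhds_unique (f := fun _ : ℕ => (σ' z / σ z).arg) tendsto_const_nhds
    (tendsto_arg_of_tendsto_real_mul (r := fun n => radialScale σ' (u n) / radialScale σ (u n))
      (fun n => div_pos (hσ'.radialScale_pos _) (hσ.radialScale_pos _)) (hlim.congr fun n => ?_))
  have hA : ((A : ℝ) : ℂ) ^ n ≠ 0 := pow_ne_zero _ (Complex.ofReal_ne_zero.2 A.2.ne')
  have hz := (u n).ne_zero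
  rw [← mul_div_mul_left _ _ hA, ← hσ'Φ.map_iterate hΦ.1, ← hσΦ.map_iterate hΦ.1,
    ← div_div_div_cancel_right₀ hz, Complex.ofReal_div, div_mul_div_comm]
  rfl

theorem Intertwines.exists_eq_mul {σ σ' Φ : ℂ → ℂ} {A : {x : ℝ // 0 < x}}
    (hσΦ : Intertwines σ Φ A) (hσ'Φ : Intertwines σ' Φ A) (hΦ : IsHyperbolicType Φ A)
    (hσ : IsAnalyticSelfMap σ) (hσ' : IsAnalyticSelfMap σ') :
    ∃ c : ℝ, 0 < c ∧ ∀ z ∈ upperHalfPlaneSet, σ' z = c * σ z := by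
  have harg := hσΦ.arg_div_eq_zero hσ'Φ hΦ hσ hσ'
  have him (z : ℍ) : (σ' z / σ z).im = 0 := (Complex.arg_eq_zero_iff.1 (harg z)).2
  have hpick : IsPick fun z => σ' z / σ z :=
    ⟨hσ'.1.differentiableOn.div hσ.1.differentiableOn fun z hz => hσ.map_ne_zero ⟨z, hz⟩,
      fun z => (him z).ge⟩
  refine ⟨‖σ' I / σ I‖, norm_pos_iff.2 (div_ne_zero (hσ'.map_ne_zero I) (hσ.map_ne_zero I)),
    fun z hz => ?_⟩
  have hI : (‖σ' I / σ I‖ : ℂ) = σ' I / σ I := by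
    simpa only [harg, Complex.ofReal_zero, zero_mul, Complex.exp_zero, mul_one] using
      Complex.norm_mul_exp_arg_mul_I (σ' I / σ I)
  rw [hI, ← hpick.eq_of_im_eq_zero (him I) ⟨z, hz⟩]
  exact (div_mul_cancel₀ _ (hσ.map_ne_zero ⟨z, hz⟩)).symm

theorem proposition2 (Φ : ℂ → ℂ) (A : ℝ) (hΦ : IsHyperbolicType Φ A)
    (σ : ℂ → ℂ) (hσ : IsAnalyticSelfMap σ) (hσΦ : Intertwines σ Φ A) :
    NonTangentialLimit σ (Bornology.cobounded ℂ) ∧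
    IsSemiConformal σ ∧
    ∀ σ' : ℂ → ℂ, IsAnalyticSelfMap σ' → Intertwines σ' Φ A →
      ∃ c : ℝ, 0 < c ∧ ∀ z ∈ upperHalfPlaneSet, σ' z = (c : ℂ) * σ z := by
  lift A to {x : ℝ // 0 < x} using one_pos.trans hΦ.2.1
  exact ⟨nonTangentialLimit_iff.2 fun _ hk => hσΦ.tendsto_cobounded hΦ hσ hk,
    nonTangentialLimit_iff.2 fun _ hk => hσΦ.tendsto_arg_div hΦ hσ hk,
    fun _ hσ' hσ'Φ => hσΦ.exists_eq_mul hσ'Φ hΦ hσ hσ'⟩
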